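/- Let $d\ge 1$, let $N\ge 1$ be an integer and let $\ell=(\ell_1,\dots,\ell_{d+1})$ be positive integers with $\ell_i\le N$ for all $i$ and $\ell_i+\ell_j\ge N$ for all $i\ne j$. Write $|y|$ for the sum of the entries of $y$ and $(a)_k=a(a+1)\cdots(a+k-1)$, and let $$V^d_{\ell,N}=\{x\in\mathbb N_0^d:\ x_i\le \ell_i\ (1\le i\le d),\ N-\ell_{d+1}\le |x|\le N\}.$$ For $\nu\in\mathbb N_0^d$ and $1\le j\le d$ put $$\mathfrak a_j=\sum_{i=j+1}^{d+1}\ell_i-2\sum_{i=j+1}^{d}\nu_i,\qquad N_j=N-\sum_{i<j}x_i-\sum_{i=j+1}^{d}\nu_i,$$ and define the Hahn polynomials with negative integer parameters by $$\mathsf Q_\nu(x;\ell,N)=\prod_{j=1}^d(-N_j)_{\nu_j}\sum_{k=0}^{\nu_j}\frac{(-\nu_j)_k\,(\nu_j-\ell_j-\mathfrak a_j-1)_k\,(-x_j)_k}{(-\ell_j)_k\,(-N_j)_k\,k!}.$$ Let $$\mathcal H^d_{\ell,N}=\{\nu\in\mathbb N_0^d:\ \nu_i\le \ell_i\ (1\le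 i\le d),\ |\nu|\le N\},$$ $$H^d_{\ell,N}=\{\nu\in\mathbb N_0^d:\ |\nu|\le N,\ |\nu|\le|\ell|-N,\ \nu_j\le\ell_j,\ \nu_j\le\mathfrak a_j\ (1\le j\le d)\}.$$ (i) For every $\nu\in\mathcal H^d_{\ell,N}$, $\mathsf Q_\nu(\cdot;\ell,N)$ is a well defined polynomial, and so is well defined on $V^d_{\ell,N}$: no denominator of the formula vanishes identically in $x\in\mathbb R^d$, and there is exactly one polynomial in $x_1,\dots,x_d$ with real coefficients that agrees with the formula at every $x\in\mathbb R^d$ at which none of its denominators vanishes; at all other points $\mathsf Q_\nu$ is given by this polynomial. (ii) If $\nu\in\mathcal H^d_{\ell,N}\setminus H^d_{\ell,N}$, then $\mathsf Q_\nu(x;\ell,N)=0$ for every $x\in V^d_{\ell,N}$. -/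

import Mathlib

open Finset

noncomputable section

/-- The Pochhammer symbol `(a)_k = a (a + 1) ⋯ (a + k - 1)`. -/
def poch (a : ℝ) (k : ℕ) : ℝ := (ascPochhammer ℝ k).eval a

/-- The classical Hahn polynomial `Q_n(x; a, b, M)`, i.e. the terminating series
`₃F₂(-n, n + a + b + 1, -x; a + 1, -M; 1)`. The value is meaningful only when none of the
denominators vanishes, see `HahnDefined`. -/
def classicalHahn (n : ℕ) (x a b M : ℝ) : ℝ :=
  ∑ k ∈ range (n + 1),
    (poch (-n) k * poch (n + a + b + 1) k * poch (-x) k) /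
      (poch (a + 1) k * poch (-M) k * k.factorial)

/-- No denominator in the series for `Q_n(x; a, b, M)` vanishes. -/
def HahnDefined (n : ℕ) (a M : ℝ) : Prop :=
  ∀ k ≤ n, poch (a + 1) k ≠ 0 ∧ poch (-M) k ≠ 0

/-- Sum of the entries of `y` strictly before position `j`. -/
def sumBefore {d : ℕ} (y : Fin d → ℝ) (j : Fin d) : ℝ := ∑ i ∈ univ.filter (· < j), y i

/-- Sum of the entries of `ν` strictly after position `j`. -/
def sumAfter {d : ℕ} (ν : Fin d → ℕ) (j : Fin d) : ℕ := ∑ i ∈ univ.filter (j < ·), ν i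

/-- `𝔞_j = (sum of ℓ_i over i > j, including the last entry) - 2 (sum of ν_i over i > j)`. -/
def zaParam {d : ℕ} (ℓ : Fin (d + 1) → ℕ) (ν : Fin d → ℕ) (j : Fin d) : ℤ :=
  ((∑ i ∈ univ.filter (j.castSucc < ·), ℓ i : ℕ) : ℤ) - 2 * (sumAfter ν j : ℤ)

/-- `N_j = N - (x_1 + ⋯ + x_{j-1}) - (ν_{j+1} + ⋯ + ν_d)`. -/
def levelN {d : ℕ} (N : ℕ) (ν : Fin d → ℕ) (x : Fin d → ℝ) (j : Fin d) : ℝ :=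
  N - sumBefore x j - sumAfter ν j

/-- The product formula for the Hahn polynomial `𝖰_ν(x; ℓ, N)` with negative integer parameters,
`∏_j (-N_j)_{ν_j} Q_{ν_j}(x_j; -ℓ_j - 1, -𝔞_j - 1, N_j)`, as an expression at the point `x`. -/
def hahnFormula {d : ℕ} (ℓ : Fin (d + 1) → ℕ) (N : ℕ) (ν : Fin d → ℕ) (x : Fin d → ℝ) : ℝ :=
  ∏ j, poch (-levelN N ν x j) (ν j) *
    classicalHahn (ν j) (x j) (-(ℓ j.castSucc : ℝ) - 1) (-(zaParam ℓ ν j : ℝ) - 1) (levelN N ν x j)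

/-- No denominator of `hahnFormula ℓ N ν` vanishes at the point `x`. -/
def HahnFormulaDefined {d : ℕ} (ℓ : Fin (d + 1) → ℕ) (N : ℕ) (ν : Fin d → ℕ) (x : Fin d → ℝ) :
    Prop :=
  ∀ j, HahnDefined (ν j) (-(ℓ j.castSucc : ℝ) - 1) (levelN N ν x j)

/-- `P` is the polynomial given by the product formula for `𝖰_ν(·; ℓ, N)`: the formula makes sense
somewhere (hence, its denominators being polynomials in `x`, on a nonempty Zariski-open set), and
`P` takes the value of the formula wherever the formula makes sense. At the remaining points the
value is that of `P`, i.e. the one obtained after cancelling the denominators. -/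
def IsHahnPolynomial {d : ℕ} (ℓ : Fin (d + 1) → ℕ) (N : ℕ) (ν : Fin d → ℕ)
    (P : MvPolynomial (Fin d) ℝ) : Prop :=
  (∃ x, HahnFormulaDefined ℓ N ν x) ∧
    ∀ x, HahnFormulaDefined ℓ N ν x → MvPolynomial.eval x P = hahnFormula ℓ N ν x

/-- The lattice points `V^d_{ℓ,N}` of the polyhedron. -/
def hahnV {d : ℕ} (ℓ : Fin (d + 1) → ℕ) (N : ℕ) : Set (Fin d → ℕ) :=
  {x | (∀ i, x i ≤ ℓ i.castSucc) ∧ (N : ℤ) - ℓ (Fin.last d) ≤ ((∑ i, x i : ℕ) : ℤ) ∧ ∑ i, x i ≤ N}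

/-- The index set `H^d_{ℓ,N}`. -/
def hahnH {d : ℕ} (ℓ : Fin (d + 1) → ℕ) (N : ℕ) : Set (Fin d → ℕ) :=
  {ν | ∑ i, ν i ≤ N ∧ ((∑ i, ν i : ℕ) : ℤ) ≤ ((∑ i, ℓ i : ℕ) : ℤ) - N ∧
    ∀ j, ν j ≤ ℓ j.castSucc ∧ (ν j : ℤ) ≤ zaParam ℓ ν j}

/-- The larger index set `𝓗^d_{ℓ,N}`. -/
def hahnCalH {d : ℕ} (ℓ : Fin (d + 1) → ℕ) (N : ℕ) : Set (Fin d → ℕ) :=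
  {ν | (∀ i, ν i ≤ ℓ i.castSucc) ∧ ∑ i, ν i ≤ N}

end

/-! Since `(-N_j)_{ν_j} / (-N_j)_k = (-N_j + k)_{ν_j - k}`, each factor is a polynomial (`regHahn`).
It is the only one matching the formula, because the denominators multiply to a nonzero polynomial.

For the vanishing, put `M = x + y`. By `regHahn_eq_sum` a factor of degree `n` is a single sum over
`m` with terms proportional to `(-x)_m (-y)_{n-m}`. For naturals with `n, x ≤ ℓ` and `y ≤ a`, it is
zero unless `n ≤ a`, `n ≤ x + y` and `n + x + y ≤ ℓ + a`. Going down from the last coordinate, these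
inequalities for factor `j` supply the hypothesis `0 ≤ y ≤ a` for factor `j - 1`; together they put
`ν` in `H`. -/

/-! ### Pochhammer identities -/

theorem poch_zero (a : ℝ) : poch a 0 = 1 := by simp [poch]

theorem poch_succ (a : ℝ) (k : ℕ) : poch a (k + 1) = poch a k * (a + k) := by
  simp [poch, ascPochhammer_succ_eval]

theorem poch_add_index (a : ℝ) (m k : ℕ) : poch a (m + k) = poch a m * poch (a + m) k := by
  simp [poch, ← ascPochhammer_mul]

theorem poch_eq_zero_iff (a : ℝ) (k : ℕ) : poch a k = 0 ↔ ∃ i < k, (i : ℝ) = -a :=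
  ascPochhammer_eval_eq_zero_iff k a

theorem poch_neg_natCast_eq_zero {m k : ℕ} (h : m < k) : poch (-(m : ℝ)) k = 0 :=
  (poch_eq_zero_iff _ _).2 ⟨m, h, by simp⟩

theorem poch_neg_natCast_ne_zero {m k : ℕ} (h : k ≤ m) : poch (-(m : ℝ)) k ≠ 0 := by
  rw [Ne, poch_eq_zero_iff]
  rintro ⟨i, hi, him⟩
  rw [neg_neg, Nat.cast_inj] at him
  omega

theorem poch_ne_zero_of_pos {a : ℝ} (h : 0 < a) (k : ℕ) : poch a k ≠ 0 :=
  (ascPochhammer_pos k a h).ne'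

theorem poch_neg (a : ℝ) (k : ℕ) : poch (-a) k = (-1) ^ k * poch (a - k + 1) k := by
  rw [poch, ascPochhammer_eval_neg_eq_descPochhammer, descPochhammer_eval_eq_ascPochhammer, poch]

theorem poch_neg_natCast_div_factorial (n k : ℕ) :
    poch (-(n : ℝ)) k / k.factorial = (-1) ^ k * n.choose k := by
  rw [poch, ascPochhammer_eval_neg_eq_descPochhammer, Nat.cast_choose_eq_descPochhammer_div,
    mul_div_assoc]

/-- The Chu–Vandermonde identity. -/
theorem poch_add (a b : ℝ) (n : ℕ) :
    poch (a + b) n = ∑ k ∈ range (n + 1), (n.choose k : ℝ) * (poch a k * poch b (n - k)) := by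
  induction n with
  | zero => simp [poch_zero]
  | succ n ih =>
    rw [sum_choose_succ_mul (fun i j => poch a i * poch b j), poch_succ, ih, sum_mul,
      ← sum_add_distrib]
    refine sum_congr rfl fun k hk => ?_
    have hkn : k ≤ n := Nat.lt_succ_iff.1 (mem_range.1 hk)
    rw [Nat.succ_sub hkn, poch_succ, poch_succ, Nat.cast_sub hkn]
    ring

/-- The terminating Gauss summation, with denominators cleared. -/
theorem sum_choose_mul_poch (b c : ℝ) (m : ℕ) :
    ∑ k ∈ range (m + 1), (-1) ^ k * (m.choose k : ℝ) * poch b k * poch (c + k) (m - k) =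
      poch (c - b) m := by
  -- Reflection by `poch_neg` turns both `(c - b)_m` and `(c + k)_{m-k}` into the shape required by
  -- Chu–Vandermonde with parameters `b` and `1 - c - m`.
  have h : c - b = -(b + (1 - c - m)) - m + 1 := by ring
  have key : poch (c - b) m = (-1) ^ m * poch (b + (1 - c - m)) m := by
    have := poch_neg (-(b + (1 - c - m))) m
    rw [neg_neg, ← h] at this
    rw [this, ← mul_assoc, ← mul_pow]
    simp
  rw [key, poch_add, mul_sum]
  refine sum_congr rfl fun k hk => ?_
  have hkm : k ≤ m := Nat.lt_succ_iff.1 (mem_range.1 hk)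
  have e := poch_neg (-(1 - c - m)) (m - k)
  rw [neg_neg, show -(1 - c - m) - ((m - k : ℕ) : ℝ) + 1 = c + k by
    rw [Nat.cast_sub hkm]; ring] at e
  rw [e, ← Nat.add_sub_of_le hkm, pow_add]
  simp only [Nat.add_sub_cancel_left]
  have h1 : ((-1 : ℝ) ^ (m - k)) * (-1) ^ (m - k) = 1 := by rw [← mul_pow]; simp
  linear_combination (-((-1) ^ k * ((k + (m - k)).choose k : ℝ) * poch b k *
    poch (c + k) (m - k))) * h1

/-! ### One-variable Hahn polynomials at lattice points -/

/-- The Hahn polynomial `(-M)_n Q_n(x; -ℓ - 1, -a - 1, M)` with the denominators `(-M)_k`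
cancelled. -/
noncomputable def regHahn (n : ℕ) (x ℓ a M : ℝ) : ℝ :=
  ∑ k ∈ range (n + 1),
    (-1) ^ k * n.choose k * poch (n - ℓ - a - 1) k / poch (-ℓ) k *
      poch (-x) k * poch (-M + k) (n - k)

theorem poch_mul_classicalHahn {n : ℕ} {ℓ M : ℝ} (h : HahnDefined n (-ℓ - 1) M) (x a : ℝ) :
    poch (-M) n * classicalHahn n x (-ℓ - 1) (-a - 1) M = regHahn n x ℓ a M := by
  rw [classicalHahn, regHahn, mul_sum]
  refine sum_congr rfl fun k hk => ?_
  have hkn : k ≤ n := Nat.lt_succ_iff.1 (mem_range.1 hk)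
  have hM := (h k hkn).2
  have e := poch_add_index (-M) k (n - k)
  rw [Nat.add_sub_of_le hkn] at e
  rw [← poch_neg_natCast_div_factorial, e, show (n : ℝ) + (-ℓ - 1) + (-a - 1) + 1 = n - ℓ - a - 1 by
    ring, show -ℓ - 1 + 1 = -ℓ by ring]
  field_simp

/-- A transformation of the terminating `₃F₂` series. -/
theorem regHahn_eq_sum {n : ℕ} {ℓ : ℝ} (hℓ : ∀ k ≤ n, poch (-ℓ) k ≠ 0) (x y a : ℝ) :
    regHahn n x ℓ a (x + y) =
      ∑ m ∈ range (n + 1),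
        (n.choose m : ℝ) * poch (a + 1 - n) m / poch (-ℓ) m * poch (-x) m * poch (-y) (n - m) := by
  -- Chu–Vandermonde for `-(x + y) + k = (-x + k) + (-y)`; the factor `(-x)_k` merges with `(-x +
  -- k)_{m-k}` into `(-x)_m`.
  have hV (k : ℕ) (hk : k ≤ n) : poch (-x) k * poch (-(x + y) + k) (n - k) =
      ∑ m ∈ Ico k (n + 1), ((n - k).choose (m - k) : ℝ) * (poch (-x) m * poch (-y) (n - m)) := by
    rw [show -(x + y) + k = (-x + k) + -y by ring, poch_add, mul_sum, sum_Ico_eq_sum_range,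
      show n + 1 - k = n - k + 1 by omega]
    refine sum_congr rfl fun i _ => ?_
    rw [poch_add_index (-x) k i, Nat.add_sub_cancel_left, show n - (k + i) = n - k - i by omega]
    ring
  calc regHahn n x ℓ a (x + y)
      = ∑ k ∈ range (n + 1), ∑ m ∈ Ico k (n + 1),
          (-1) ^ k * n.choose k * poch (n - ℓ - a - 1) k / poch (-ℓ) k *
          (((n - k).choose (m - k) : ℝ) * (poch (-x) m * poch (-y) (n - m))) := by
        refine sum_congr rfl fun k hk => ?_
        rw [mul_assoc, hV k (Nat.lt_succ_iff.1 (mem_range.1 hk)), mul_sum]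
    _ = ∑ m ∈ range (n + 1), ∑ k ∈ range (m + 1),
          (-1) ^ k * n.choose k * poch (n - ℓ - a - 1) k / poch (-ℓ) k *
          (((n - k).choose (m - k) : ℝ) * (poch (-x) m * poch (-y) (n - m))) := by
        refine sum_comm' fun k m => ?_
        simp only [mem_range, mem_Ico]
        omega
    _ = _ := by
        refine sum_congr rfl fun m hm => ?_
        have hmn : m ≤ n := Nat.lt_succ_iff.1 (mem_range.1 hm)
        -- After the exchange of sums, the coefficient of `(-x)_m (-y)_{n-m}` is a terminating Gauss
        -- sum.
        have hG := sum_choose_mul_poch (n - ℓ - a - 1) (-ℓ) m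
        rw [show -ℓ - (n - ℓ - a - 1) = a + 1 - n by ring] at hG
        rw [← hG, mul_sum, sum_div, sum_mul, sum_mul]
        refine sum_congr rfl fun k hk => ?_
        have hkm : k ≤ m := Nat.lt_succ_iff.1 (mem_range.1 hk)
        have e := poch_add_index (-ℓ) k (m - k)
        rw [Nat.add_sub_of_le hkm] at e
        have hk0 := hℓ k (hkm.trans hmn)
        have hm0 := hℓ m hmn
        have hmk0 : poch (-ℓ + k) (m - k) ≠ 0 := fun h => hm0 (by rw [e, h, mul_zero])
        have hc : (n.choose m : ℝ) * m.choose k = n.choose k * (n - k).choose (m - k) := by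
          exact_mod_cast Nat.choose_mul hkm
        rw [e]
        field_simp
        linear_combination
          (-(poch (n - ℓ - a - 1) k * poch (-x) m * poch (-y) (n - m))) * hc

theorem sum_neg_one_pow_choose_mul_eval {n : ℕ} {p : Polynomial ℝ} (hp : p.natDegree < n) :
    ∑ k ∈ range (n + 1), (-1) ^ k * (n.choose k : ℝ) * p.eval (k : ℝ) = 0 := by
  have h := congrFun (Polynomial.fwdDiff_iter_eq_zero_of_degree_lt hp) 0
  rw [fwdDiff_iter_eq_sum_shift] at h
  have h' := congrArg (fun t => (-1 : ℝ) ^ n * t) h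
  simp only [Pi.zero_apply, mul_zero, mul_sum] at h'
  rw [← h']
  refine sum_congr rfl fun k hk => ?_
  have hkn : k ≤ n := Nat.lt_succ_iff.1 (mem_range.1 hk)
  have e : (-1 : ℝ) ^ n * (-1) ^ (n - k) = (-1) ^ k := by
    conv_lhs => rw [← Nat.add_sub_of_le hkn, Nat.add_sub_cancel_left, pow_add, mul_assoc, ← mul_pow]
    simp
  simp only [zsmul_eq_mul, zero_add, nsmul_eq_mul, mul_one]
  push_cast
  rw [← e]
  ring

/-- Two splittings of `(-ℓ)_{m+ℓ-x}`. Hence `(-x)_m / (-ℓ)_m`, where defined, is a polynomial in `m`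
of degree `ℓ - x`. -/
theorem poch_neg_natCast_mul_comm {x ℓ : ℕ} (hx : x ≤ ℓ) (m : ℕ) :
    poch (-(ℓ : ℝ)) m * poch (-(ℓ : ℝ) + m) (ℓ - x) =
      poch (-(ℓ : ℝ)) (ℓ - x) * poch (-(x : ℝ)) m := by
  rw [← poch_add_index, add_comm m, poch_add_index, Nat.cast_sub hx]
  congr 2
  ring

/-- `(-x)_m` kills the terms `m > x` and `(-y)_{n-m}` the terms `m < n - y`; no term survives. -/
theorem regHahn_eq_zero_of_lt_add {n ℓ a x y : ℕ} (hn : n ≤ ℓ) (h : x + y < n) :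
    regHahn n x ℓ a (x + y) = 0 := by
  rw [regHahn_eq_sum fun k hk => poch_neg_natCast_ne_zero (hk.trans hn)]
  refine sum_eq_zero fun m hm => ?_
  rcases lt_or_ge x m with hxm | hxm
  · rw [poch_neg_natCast_eq_zero hxm, mul_zero, zero_mul]
  · rw [poch_neg_natCast_eq_zero (show y < n - m by omega), mul_zero]

/-- `(-y)_{n-m}` kills the terms `m < n - y`, and `(a + 1 - n)_m` the terms `m ≥ n - a`; these
overlap or meet because `y ≤ a`. -/
theorem regHahn_eq_zero_of_lt {n ℓ a x y : ℕ} (hn : n ≤ ℓ) (hy : y ≤ a) (h : a < n) :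
    regHahn n x ℓ a (x + y) = 0 := by
  rw [regHahn_eq_sum fun k hk => poch_neg_natCast_ne_zero (hk.trans hn)]
  refine sum_eq_zero fun m hm => ?_
  rcases lt_or_ge y (n - m) with hym | hym
  · rw [poch_neg_natCast_eq_zero hym, mul_zero]
  · have : poch ((a : ℝ) + 1 - n) m = 0 := by
      rw [show (a : ℝ) + 1 - n = -((n - (a + 1) : ℕ) : ℝ) by
        rw [Nat.cast_sub h]; push_cast; ring]
      exact poch_neg_natCast_eq_zero (by omega)
    rw [this]
    simp

/-- Up to a constant, the sum is an `n`-th finite difference of a polynomial in `m` of degree `(ℓ -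
x) + (a - y) < n`. -/
theorem regHahn_eq_zero_of_add_lt {n ℓ a x y : ℕ} (hn : n ≤ ℓ) (hx : x ≤ ℓ)
    (hy : y ≤ a) (h : ℓ + a < n + x + y) : regHahn n x ℓ a (x + y) = 0 := by
  rw [regHahn_eq_sum fun k hk => poch_neg_natCast_ne_zero (hk.trans hn)]
  let p : Polynomial ℝ :=
    (ascPochhammer ℝ (ℓ - x)).comp (Polynomial.X - Polynomial.C (ℓ : ℝ)) *
      (ascPochhammer ℝ (a - y)).comp (Polynomial.C ((n : ℝ) - a) - Polynomial.X)
  have hp : p.natDegree < n := by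
    refine (Polynomial.natDegree_mul_le).trans_lt ?_
    rw [Polynomial.natDegree_comp, Polynomial.natDegree_comp, Polynomial.natDegree_X_sub_C,
      ascPochhammer_natDegree, ascPochhammer_natDegree]
    have : (Polynomial.C ((n : ℝ) - a) - Polynomial.X).natDegree = 1 := by
      rw [Polynomial.natDegree_sub, Polynomial.natDegree_X_sub_C]
    rw [this]
    omega
  have hℓ0 : poch (-(ℓ : ℝ)) (ℓ - x) ≠ 0 := poch_neg_natCast_ne_zero (Nat.sub_le _ _)
  have ha0 : poch (-(a : ℝ)) (a - y) ≠ 0 := poch_neg_natCast_ne_zero (Nat.sub_le _ _)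
  rw [← mul_zero (poch (-(a : ℝ)) n / (poch (-(ℓ : ℝ)) (ℓ - x) * poch (-(a : ℝ)) (a - y))),
    ← sum_neg_one_pow_choose_mul_eval hp, mul_sum]
  refine sum_congr rfl fun m hm => ?_
  have hmn : m ≤ n := Nat.lt_succ_iff.1 (mem_range.1 hm)
  have hpe : p.eval (m : ℝ) =
      poch (-(ℓ : ℝ) + m) (ℓ - x) * poch (-(a : ℝ) + (n - m : ℕ)) (a - y) := by
    simp only [p, Polynomial.eval_mul, Polynomial.eval_comp, Polynomial.eval_sub,
      Polynomial.eval_X, Polynomial.eval_C, poch, Nat.cast_sub hmn]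
    congr 2 <;> ring_nf
  have hℓm : poch (-(ℓ : ℝ)) m ≠ 0 := poch_neg_natCast_ne_zero (hmn.trans hn)
  have e1 := poch_neg_natCast_mul_comm hx m
  -- `(-a)_{n-m}` may vanish, as `n ≤ a` is not assumed, so it is kept as a factor of `(-a)_n` and
  -- never divided by.
  have e2 := poch_neg_natCast_mul_comm hy (n - m)
  have e3 := poch_add_index (-(a : ℝ)) (n - m) m
  rw [Nat.sub_add_cancel hmn] at e3
  have e4 : poch (-(a : ℝ) + (n - m : ℕ)) m = (-1) ^ m * poch ((a : ℝ) + 1 - n) m := by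
    rw [show -(a : ℝ) + (n - m : ℕ) = -((a : ℝ) - (n - m : ℕ)) by ring, poch_neg,
      Nat.cast_sub hmn]
    congr 2
    ring
  have e5 : ((-1 : ℝ) ^ m) * (-1) ^ m = 1 := by rw [← mul_pow]; simp
  have e1' : poch (-(ℓ : ℝ) + m) (ℓ - x) =
      poch (-(ℓ : ℝ)) (ℓ - x) * poch (-(x : ℝ)) m / poch (-(ℓ : ℝ)) m := by
    rw [← e1]; field_simp
  rw [hpe, e1', e3, e4]
  field_simp
  linear_combination (-((n.choose m : ℝ) * poch ((a : ℝ) + 1 - n) m * poch (-(x : ℝ)) m)) *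
    ((-1 : ℝ) ^ m * (-1) ^ m * e2 + poch (-(a : ℝ)) (a - y) * poch (-(y : ℝ)) (n - m) * e5)

/-- The index conditions are forced at a lattice point where the factor does not vanish. -/
theorem index_le_of_regHahn_ne_zero {n ℓ a x y : ℕ} (hn : n ≤ ℓ) (hx : x ≤ ℓ) (hy : y ≤ a)
    (h : regHahn n x ℓ a (x + y) ≠ 0) : n ≤ a ∧ n ≤ x + y ∧ n + x + y ≤ ℓ + a := by
  have hna : n ≤ a := not_lt.1 fun h' => h (regHahn_eq_zero_of_lt hn hy h')
  exact ⟨hna, not_lt.1 fun h' => h (regHahn_eq_zero_of_lt_add hn h'),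
    not_lt.1 fun h' => h (regHahn_eq_zero_of_add_lt hn hx hy h')⟩

/-! ### Tail sums -/

/-- Sum of the entries of `f` from position `m` on. -/
def tailSum {n : ℕ} (f : Fin n → ℕ) (m : ℕ) : ℕ := ∑ i ∈ univ.filter (m ≤ ·.val), f i

theorem tailSum_zero {n : ℕ} (f : Fin n → ℕ) : tailSum f 0 = ∑ i, f i := by simp [tailSum]

theorem tailSum_self {n : ℕ} (f : Fin n → ℕ) : tailSum f n = 0 := by
  simp [tailSum]

theorem tailSum_eq_add {n : ℕ} (f : Fin n → ℕ) (j : Fin n) :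
    tailSum f j = f j + tailSum f (j + 1) := by
  have : univ.filter (fun i : Fin n => j.val ≤ i.val) =
      insert j (univ.filter fun i : Fin n => j.val + 1 ≤ i.val) := by
    ext i
    simp only [mem_filter, mem_univ, true_and, mem_insert, Fin.ext_iff]
    omega
  rw [tailSum, this, sum_insert (by simp), tailSum]

theorem sumAfter_eq_tailSum {d : ℕ} (ν : Fin d → ℕ) (j : Fin d) :
    sumAfter ν j = tailSum ν (j + 1) := rfl

theorem zaParam_eq_tailSum {d : ℕ} (ℓ : Fin (d + 1) → ℕ) (ν : Fin d → ℕ) (j : Fin d) :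
    zaParam ℓ ν j = (tailSum ℓ (j + 1) : ℤ) - 2 * tailSum ν (j + 1) := rfl

theorem sumBefore_add_tailSum {d : ℕ} (x : Fin d → ℕ) (j : Fin d) :
    sumBefore (fun i => (x i : ℝ)) j + tailSum x j = ∑ i, (x i : ℝ) := by
  rw [sumBefore, tailSum, Nat.cast_sum, ← sum_filter_add_sum_filter_not univ (· < j)]
  simp only [not_lt, Fin.le_def]

/-! ### Existence and uniqueness of the polynomial -/

/-- The product formula with the denominators `(-N_j)_k` cancelled. -/
noncomputable def regHahnProd {d : ℕ} (ℓ : Fin (d + 1) → ℕ) (N : ℕ) (ν : Fin d → ℕ)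
    (x : Fin d → ℝ) : ℝ :=
  ∏ j, regHahn (ν j) (x j) (ℓ j.castSucc) (zaParam ℓ ν j) (levelN N ν x j)

theorem hahnFormula_eq_regHahnProd {d : ℕ} {ℓ : Fin (d + 1) → ℕ} {N : ℕ} {ν : Fin d → ℕ}
    {x : Fin d → ℝ} (h : HahnFormulaDefined ℓ N ν x) :
    hahnFormula ℓ N ν x = regHahnProd ℓ N ν x :=
  prod_congr rfl fun j _ => poch_mul_classicalHahn (h j) _ _

/-- `poch` with a polynomial argument. -/
noncomputable def mvPoch {d : ℕ} (p : MvPolynomial (Fin d) ℝ) (k : ℕ) : MvPolynomial (Fin d) ℝ :=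
  Polynomial.aeval p (ascPochhammer ℝ k)

theorem eval_mvPoch {d : ℕ} (p : MvPolynomial (Fin d) ℝ) (k : ℕ) (x : Fin d → ℝ) :
    MvPolynomial.eval x (mvPoch p k) = poch (MvPolynomial.eval x p) k := by
  rw [mvPoch, poch, ← MvPolynomial.coe_aeval_eq_eval, RingHom.coe_coe,
    ← Polynomial.aeval_algHom_apply, Polynomial.coe_aeval_eq_eval]

/-- `levelN` as a polynomial in `x`. -/
noncomputable def levelPoly {d : ℕ} (N : ℕ) (ν : Fin d → ℕ) (j : Fin d) :
    MvPolynomial (Fin d) ℝ :=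
  (N : MvPolynomial (Fin d) ℝ) - (∑ i ∈ univ.filter (· < j), MvPolynomial.X i) -
    (sumAfter ν j : MvPolynomial (Fin d) ℝ)

theorem eval_levelPoly {d : ℕ} (N : ℕ) (ν : Fin d → ℕ) (j : Fin d) (x : Fin d → ℝ) :
    MvPolynomial.eval x (levelPoly N ν j) = levelN N ν x j := by
  simp [levelPoly, levelN, sumBefore]

/-- The Hahn polynomial in several variables. -/
noncomputable def hahnPoly {d : ℕ} (ℓ : Fin (d + 1) → ℕ) (N : ℕ) (ν : Fin d → ℕ) :
    MvPolynomial (Fin d) ℝ :=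
  ∏ j, ∑ k ∈ range (ν j + 1),
    MvPolynomial.C ((-1) ^ k * (ν j).choose k *
      poch (ν j - ℓ j.castSucc - zaParam ℓ ν j - 1) k / poch (-(ℓ j.castSucc : ℝ)) k) *
      mvPoch (-MvPolynomial.X j) k *
      mvPoch (-levelPoly N ν j + (k : MvPolynomial (Fin d) ℝ)) (ν j - k)

theorem eval_hahnPoly {d : ℕ} (ℓ : Fin (d + 1) → ℕ) (N : ℕ) (ν : Fin d → ℕ) (x : Fin d → ℝ) :
    MvPolynomial.eval x (hahnPoly ℓ N ν) = regHahnProd ℓ N ν x := by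
  simp only [hahnPoly, regHahnProd, regHahn, map_prod, map_sum, map_mul, MvPolynomial.eval_C,
    eval_mvPoch, map_neg, map_add, MvPolynomial.eval_X, eval_levelPoly, map_natCast]

/-- The product of the denominators of the formula that depend on `x`. -/
noncomputable def denomPoly {d : ℕ} (N : ℕ) (ν : Fin d → ℕ) : MvPolynomial (Fin d) ℝ :=
  ∏ j, ∏ k ∈ range (ν j + 1), mvPoch (-levelPoly N ν j) k

theorem eval_denomPoly_ne_zero_iff {d : ℕ} {ℓ : Fin (d + 1) → ℕ} {N : ℕ} {ν : Fin d → ℕ}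
    (hν : ∀ i, ν i ≤ ℓ i.castSucc) (x : Fin d → ℝ) :
    MvPolynomial.eval x (denomPoly N ν) ≠ 0 ↔ HahnFormulaDefined ℓ N ν x := by
  simp only [denomPoly, map_prod, eval_mvPoch, map_neg, eval_levelPoly, Ne, prod_eq_zero_iff,
    mem_univ, true_and, mem_range, Nat.lt_succ_iff, HahnFormulaDefined, HahnDefined]
  push Not
  refine forall_congr' fun j => forall_congr' fun k => forall_congr' fun hk => ?_
  rw [sub_add_cancel]
  exact (and_iff_right (poch_neg_natCast_ne_zero (hk.trans (hν j)))).symm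

theorem exists_hahnFormulaDefined {d : ℕ} {ℓ : Fin (d + 1) → ℕ} {N : ℕ} {ν : Fin d → ℕ}
    (hν : ν ∈ hahnCalH ℓ N) : ∃ x, HahnFormulaDefined ℓ N ν x := by
  -- For `j` not first, one earlier entry `N + 1` already makes `-N_j` positive. For the first `j`,
  -- `N_j` is a natural number at least `ν_j`, since `|ν| ≤ N`.
  refine ⟨fun _ => N + 1, fun j k hk => ⟨?_, ?_⟩⟩
  · rw [sub_add_cancel]
    exact poch_neg_natCast_ne_zero (hk.trans (hν.1 j))
  · rw [levelN]
    by_cases hj : ∃ i, i < j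
    · obtain ⟨i, hi⟩ := hj
      refine poch_ne_zero_of_pos ?_ _
      have h1 : (N : ℝ) + 1 ≤ sumBefore (fun _ : Fin d => (N : ℝ) + 1) j :=
        single_le_sum (f := fun _ : Fin d => (N : ℝ) + 1) (fun _ _ => by positivity)
          (mem_filter.2 ⟨mem_univ i, hi⟩)
      have h2 : (0 : ℝ) ≤ sumAfter ν j := Nat.cast_nonneg _
      linarith
    · push Not at hj
      have h0 : sumBefore (fun _ : Fin d => (N : ℝ) + 1) j = 0 := by
        rw [sumBefore, filter_false_of_mem fun i _ => not_lt.2 (hj i), sum_empty]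
      have h1 : ν j + sumAfter ν j ≤ N := by
        have h2 : tailSum ν j ≤ ∑ i, ν i := sum_le_sum_of_subset (filter_subset _ _)
        rw [tailSum_eq_add, ← sumAfter_eq_tailSum] at h2
        exact h2.trans hν.2
      rw [h0, sub_zero, ← Nat.cast_sub (by omega)]
      exact poch_neg_natCast_ne_zero (by omega)

theorem isHahnPolynomial_hahnPoly {d : ℕ} {ℓ : Fin (d + 1) → ℕ} {N : ℕ} {ν : Fin d → ℕ}
    (hν : ν ∈ hahnCalH ℓ N) : IsHahnPolynomial ℓ N ν (hahnPoly ℓ N ν) :=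
  ⟨exists_hahnFormulaDefined hν, fun x hx => by
    rw [eval_hahnPoly, hahnFormula_eq_regHahnProd hx]⟩

/-- The difference times `denomPoly` vanishes at every real point, hence is zero, and the polynomial
ring is a domain. -/
theorem IsHahnPolynomial.eq_hahnPoly {d : ℕ} {ℓ : Fin (d + 1) → ℕ} {N : ℕ} {ν : Fin d → ℕ}
    (hν : ν ∈ hahnCalH ℓ N) {P : MvPolynomial (Fin d) ℝ} (hP : IsHahnPolynomial ℓ N ν P) :
    P = hahnPoly ℓ N ν := by
  have hD : denomPoly N ν ≠ 0 := by
    obtain ⟨x, hx⟩ := hP.1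
    intro h
    refine (eval_denomPoly_ne_zero_iff hν.1 x).2 hx ?_
    rw [h, map_zero]
  have h : denomPoly N ν * (P - hahnPoly ℓ N ν) = 0 := by
    refine MvPolynomial.funext fun x => ?_
    rw [map_mul, map_sub, map_zero]
    by_cases hx : HahnFormulaDefined ℓ N ν x
    · rw [hP.2 x hx, (isHahnPolynomial_hahnPoly hν).2 x hx, sub_self, mul_zero]
    · rw [not_not.1 (mt (eval_denomPoly_ne_zero_iff hν.1 x).1 hx), zero_mul]
  exact sub_eq_zero.1 ((mul_eq_zero.1 h).resolve_left hD)

/-! ### Vanishing on `V` -/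

/-- At a lattice point of `V` where no factor vanishes, the index satisfies all the constraints:
with `X_m = x_m + ⋯ + x_{d+1}` and `x_{d+1} = N - |x|`, the tail sums of `ν` are bounded both by
`X_m` and by the tail sums of `ℓ - x`. -/
theorem tailSum_le_of_regHahnProd_ne_zero {d : ℕ} {ℓ : Fin (d + 1) → ℕ} {N : ℕ} {ν x : Fin d → ℕ}
    (hν : ∀ i, ν i ≤ ℓ i.castSucc) (hx : x ∈ hahnV ℓ N)
    (h : regHahnProd ℓ N ν (fun i => x i) ≠ 0) {m : ℕ} (hm : m ≤ d) :
    tailSum ν m ≤ tailSum x m + (N - ∑ i, x i) ∧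
      tailSum ν m + tailSum x m + (N - ∑ i, x i) ≤ tailSum ℓ m ∧
      ∀ j : Fin d, m ≤ j → (ν j : ℤ) ≤ zaParam ℓ ν j := by
  obtain ⟨hx1, hx2, hx3⟩ := hx
  induction hm using Nat.decreasingInduction with
  | self =>
    have hd : tailSum ℓ d = ℓ (Fin.last d) := by
      have := tailSum_eq_add ℓ (Fin.last d)
      rwa [Fin.val_last, tailSum_self, add_zero] at this
    rw [tailSum_self, tailSum_self, hd]
    exact ⟨by omega, by omega, fun j hj => absurd j.2 (by omega)⟩
  | of_succ m hm ih =>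
    obtain ⟨ih1, ih2, ih3⟩ := ih
    let j : Fin d := ⟨m, hm⟩
    have eν : tailSum ν m = ν j + tailSum ν (m + 1) := tailSum_eq_add ν j
    have ex : tailSum x m = x j + tailSum x (m + 1) := tailSum_eq_add x j
    have eℓ : tailSum ℓ m = ℓ j.castSucc + tailSum ℓ (m + 1) := tailSum_eq_add ℓ j.castSucc
    have hj := prod_ne_zero_iff.1 h j (mem_univ j)
    -- The two bounds at `m + 1` add up to `2 * tailSum ν (m + 1) ≤ tailSum ℓ (m + 1)`, so `𝔞_j ≥
    -- 0`.
    obtain ⟨a, ha⟩ : ∃ a : ℕ, zaParam ℓ ν j = a := Int.eq_ofNat_of_zero_le (by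
      rw [zaParam_eq_tailSum]
      simp only [j]
      omega)
    -- This `y` is `N_j - x_j`; the bounds at `m + 1` say exactly `0 ≤ y ≤ 𝔞_j`.
    obtain ⟨y, hy⟩ : ∃ y, tailSum ν (m + 1) + y = tailSum x (m + 1) + (N - ∑ i, x i) :=
      ⟨_, Nat.add_sub_of_le ih1⟩
    have ha' := ha
    rw [zaParam_eq_tailSum] at ha'
    simp only [j] at ha'
    have hlevel : levelN N ν (fun i => (x i : ℝ)) j = x j + y := by
      have e := sumBefore_add_tailSum x j
      have hy' : (tailSum ν (m + 1) + y : ℝ) = tailSum x (m + 1) + (N - ∑ i, (x i : ℝ)) := by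
        rw [← Nat.cast_sum, ← Nat.cast_sub hx3]
        exact_mod_cast hy
      have ex' : (tailSum x m : ℝ) = x j + tailSum x (m + 1) := by exact_mod_cast ex
      rw [levelN, sumAfter_eq_tailSum]
      simp only [j] at e ⊢ ex'
      linarith
    rw [hlevel, ha, Int.cast_natCast] at hj
    obtain ⟨h1, h2, h3⟩ := index_le_of_regHahn_ne_zero (hν j) (hx1 j) (by omega) hj
    refine ⟨by omega, by omega, fun i hi => ?_⟩
    rcases hi.eq_or_lt with hi | hi
    · obtain rfl : j = i := Fin.ext hi
      rw [ha]
      exact_mod_cast h1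
    · exact ih3 i hi

theorem mem_hahnH_of_regHahnProd_ne_zero {d : ℕ} {ℓ : Fin (d + 1) → ℕ} {N : ℕ} {ν x : Fin d → ℕ}
    (hν : ν ∈ hahnCalH ℓ N) (hx : x ∈ hahnV ℓ N)
    (h : regHahnProd ℓ N ν (fun i => x i) ≠ 0) : ν ∈ hahnH ℓ N := by
  obtain ⟨-, h2, h3⟩ := tailSum_le_of_regHahnProd_ne_zero hν.1 hx h d.zero_le
  have hxN := hx.2.2
  -- At `m = 0` the entries of `x`, with `x_{d+1}`, sum to `N`, so the second bound reads `|ν| + N ≤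
  -- |ℓ|`.
  simp only [tailSum_zero] at h2
  exact ⟨hν.2, by omega, fun j => ⟨hν.1 j, h3 j (Nat.zero_le _)⟩⟩

theorem theorem3p4 (d : ℕ) (ℓ : Fin (d + 1) → ℕ) (N : ℕ) (hN : 0 < N) (hℓ : ∀ i, 0 < ℓ i)
    (hℓN : ∀ i, ℓ i ≤ N) (hℓℓ : ∀ i j, i ≠ j → N ≤ ℓ i + ℓ j) :
    (∀ ν ∈ hahnCalH ℓ N, ∃! P : MvPolynomial (Fin d) ℝ, IsHahnPolynomial ℓ N ν P) ∧
    (∀ ν ∈ hahnCalH ℓ N \ hahnH ℓ N, ∀ P : MvPolynomial (Fin d) ℝ, IsHahnPolynomial ℓ N ν P →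
      ∀ x ∈ hahnV ℓ N, MvPolynomial.eval (fun i => (x i : ℝ)) P = 0) := by
  refine ⟨fun ν hν => ⟨_, isHahnPolynomial_hahnPoly hν, fun P hP => hP.eq_hahnPoly hν⟩, ?_⟩
  intro ν hν P hP x hx
  rw [hP.eq_hahnPoly hν.1, eval_hahnPoly]
  by_contra h
  exact hν.2 (mem_hahnH_of_regHahnProd_ne_zero hν.1 hx h)
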